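/- **Setting.** Let $\mathit{Sig}$ be a (possibly infinite) set of function symbols ranked over the natural numbers, let $\mathit{Vars}$ be a set of variables, and let $\mathit{VI} \subseteq \mathit{Vars}$ be a fixed finite set (the variables of interest). A *term* is a possibly infinite ordered tree whose inner nodes are labelled by function symbols whose rank is the number of children, and whose leaves are labelled by variables or by symbols of rank $0$; $\mathit{HTerms}$ is the set of finite terms. $\mathrm{vars}(t)$ is the set of variables occurring in $t$; $\mathrm{occ\_lin}(y,t)$ means that $y$ occurs exactly once in $t$; $t$ is *ground* ($t \in \mathit{GTerms}$) if $\mathrm{vars}(t)=\emptyset$, and *linear* ($t\in\mathit{LTerms}$) if $\mathrm{occ\_lin}(y,t)$ for all $y \in \mathrm{vars}(t)$. A *substitution* is a map $\sigma : \mathit{Vars} \to \mathit{HTerms}$ whose domain $\mathrm{dom}(\sigma) = \{x \mid \sigma(x) \neq x\}$ is finite, extended homomorphically to $\mathit{HTerms}$; $t\sigma^n$ is the result of applying it $n$ times to $t$, and $\#\sigma$ is the number of elements of $\mathrm{dom}(\sigma)$. $\mathit{RSubst}$ is the set of substitutions in *rational solved form*, i.e. those for which there are no $n>1$ and distinct variables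 $x_1,\dots,x_n$ with $\sigma(x_i) = x_{i+1}$ for $i<n$ and $\sigma(x_n)=x_1$. For $\sigma\in\mathit{RSubst}$ and $s \in \mathit{HTerms}$ the sequence $s, s\sigma, s\sigma^2,\dots$ converges (it is eventually constant down to each fixed depth) to a term, denoted $\mathrm{rt}(s,\sigma)$. For $\sigma\in\mathit{RSubst}$ with $n=\#\sigma$, let - $\mathrm{occ}(\sigma,v) = \{y \in \mathit{Vars} \mid v \in \mathrm{vars}(y\sigma^n)\setminus \mathrm{dom}(\sigma)\}$ and $\mathrm{ssets}(\sigma) = \{\mathrm{occ}(\sigma,v)\cap \mathit{VI} \mid v\in\mathit{Vars}\}\setminus\{\emptyset\}$; - $\mathrm{fvars}(\sigma) = \{y \in \mathit{Vars} \mid y\sigma^n\in\mathit{Vars}\}$; - $\mathrm{lvars}(\sigma) = \{y \in \mathit{Vars} \mid \forall z \in \mathrm{vars}(y\sigma^n)\setminus\mathrm{dom}(\sigma) : \mathrm{occ\_lin}(z,y\sigma^{2n})\}$. An element $d=\langle \mathit{sh},f,l\rangle$ of the domain $\mathit{SFL}$ consists of a set $\mathit{sh}$ of nonempty subsets of $\mathit{VI}$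 and of subsets $f,l\subseteq\mathit{VI}$. Its concretization is $$\gamma_S(d) = \{\sigma\in\mathit{RSubst} \mid \mathrm{ssets}(\sigma)\subseteq \mathit{sh},\ \mathrm{fvars}(\sigma)\supseteq f,\ \mathrm{lvars}(\sigma)\supseteq l\}.$$ With $\mathrm{rel}(W,\mathit{sh}) = \{S\in\mathit{sh} \mid S\cap W\neq\emptyset\}$, define for finite terms $s,t$ with variables in $\mathit{VI}$: - $\mathrm{ind}_d(s,t)$ iff $\mathrm{rel}(\mathrm{vars}(s),\mathit{sh})\cap\mathrm{rel}(\mathrm{vars}(t),\mathit{sh})=\emptyset$; - $\mathrm{ground}_d(t)$ iff $\mathrm{vars}(t)\subseteq\mathit{VI}\setminus\bigcup\mathit{sh}$; - $\mathrm{occ\_lin}_d(y,t)$ iff $\mathrm{ground}_d(y)$, or $\mathrm{occ\_lin}(y,t)$ and $y\in l$ and $\mathrm{ind}_d(y,z)$ for all $z\in\mathrm{vars}(t)$ with $z\neq y$; - $\mathrm{free}_d(t)$ iff $t\in f$ (in particular $t$ is a variable); - $\mathrm{lin}_d(t)$ iff $\mathrm{occ\_lin}_d(y,t)$ for all $y\in\mathrm{vars}(t)$;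 - $\mathrm{share\_with}_d(t) = \bigcup\mathrm{rel}(\mathrm{vars}(t),\mathit{sh})$. **Theorem.** Let $d\in\mathit{SFL}$, $\sigma\in\gamma_S(d)$ and $y\in\mathit{VI}$, and let $s,t\in\mathit{HTerms}$ be finite terms with $\mathrm{vars}(s)\cup\mathrm{vars}(t)\subseteq\mathit{VI}$. Then 1. $\mathrm{ind}_d(s,t)$ implies $\mathrm{vars}(\mathrm{rt}(s,\sigma))\cap\mathrm{vars}(\mathrm{rt}(t,\sigma))=\emptyset$; 2. $\mathrm{ind}_d(y,t)$ holds if and only if $y\notin\mathrm{share\_with}_d(t)$; 3. $\mathrm{free}_d(t)$ implies $\mathrm{rt}(t,\sigma)\in\mathit{Vars}$; 4. $\mathrm{ground}_d(t)$ implies $\mathrm{rt}(t,\sigma)\in\mathit{GTerms}$; 5. $\mathrm{lin}_d(t)$ implies $\mathrm{rt}(t,\sigma)\in\mathit{LTerms}$. -/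

import Mathlib

universe u v w

namespace RationalTrees

/-! ### Possibly infinite terms

The ranked signature is the family `L.Functions n` of symbols of rank `n` of a Mathlib language `L`
(its relation symbols play no role), `V` is the set of variables.  Finite (Herbrand) terms are
Mathlib's `L.Term V`. -/

/-- The label of a node: a variable or a function symbol together with its rank. -/
abbrev NodeLabel (L : FirstOrder.Language.{u, v}) (V : Type w) := V ⊕ (Σ n, L.Functions n)

/-- A possibly infinite term, as an ordered labelled tree: nodes are addressed by the list of child
indices leading to them from the root, and `label p = none` says that there is no node at `p`. -/
@[ext]
structure TreeTerm (L : FirstOrder.Language.{u, v}) (V : Type w) where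
  label : List ℕ → Option (NodeLabel L V)
  label_nil : label [] ≠ none
  label_snoc : ∀ (p : List ℕ) (i : ℕ), label (p ++ [i]) ≠ none ↔
    ∃ (n : ℕ) (f : L.Functions n), label p = some (Sum.inr ⟨n, f⟩) ∧ i < n

section Terms

variable {L : FirstOrder.Language.{u, v}} {V : Type w}

/-- The node labels of a finite term. -/
def termLabel : L.Term V → List ℕ → Option (NodeLabel L V)
  | .var x, [] => some (Sum.inl x)
  | .var _, _ :: _ => none
  | .func f _, [] => some (Sum.inr ⟨_, f⟩)
  | .func (l := n) _ ts, i :: p => if h : i < n then termLabel (ts ⟨i, h⟩) p else none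

theorem termLabel_nil (t : L.Term V) : termLabel t [] ≠ none := by
  cases t <;> simp [termLabel]

theorem termLabel_snoc (t : L.Term V) : ∀ (p : List ℕ) (i : ℕ),
    termLabel t (p ++ [i]) ≠ none ↔
      ∃ (n : ℕ) (f : L.Functions n), termLabel t p = some (Sum.inr ⟨n, f⟩) ∧ i < n := by
  induction t with
  | var x =>
    intro p i
    cases p <;> simp [termLabel]
  | @func n f ts ih =>
    intro p i
    cases p with
    | nil =>
      constructor
      · intro h
        refine ⟨n, f, by simp [termLabel], ?_⟩
        by_contra hi
        simp [termLabel, hi] at h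
      · rintro ⟨m, g, h, hi⟩
        simp only [termLabel, Option.some.injEq, Sum.inr.injEq, Sigma.mk.injEq] at h
        obtain ⟨rfl, -⟩ := h
        simp [termLabel, hi, termLabel_nil]
    | cons j p =>
      by_cases hj : j < n
      · simpa [termLabel, hj] using ih ⟨j, hj⟩ p i
      · simp [termLabel, hj]

/-- A finite term, seen as a possibly infinite one. -/
def ofTerm (t : L.Term V) : TreeTerm L V where
  label := termLabel t
  label_nil := termLabel_nil t
  label_snoc := termLabel_snoc t

/-- The set of variables occurring in a term. -/
def vars (t : TreeTerm L V) : Set V := {x | ∃ p, t.label p = some (Sum.inl x)}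

/-- `y` occurs exactly once in `t`. -/
def OccLin (y : V) (t : TreeTerm L V) : Prop := ∃! p, t.label p = some (Sum.inl y)

/-- The variables, as a set of terms. -/
def VarTerms : Set (TreeTerm L V) := {t | ∃ x : V, t = ofTerm (FirstOrder.Language.Term.var x)}

/-- The ground terms. -/
def GTerms : Set (TreeTerm L V) := {t | vars t = ∅}

/-- The linear terms. -/
def LTerms : Set (TreeTerm L V) := {t | ∀ y ∈ vars t, OccLin y t}

/-- Convergence of a sequence of terms: for every depth `k`, the sequence eventually agrees with
its limit down to depth `k`. -/
def ConvergesTo (a : ℕ → TreeTerm L V) (t : TreeTerm L V) : Prop :=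
  ∀ k, ∃ N, ∀ n, N ≤ n → ∀ p : List ℕ, p.length ≤ k → (a n).label p = t.label p

theorem ConvergesTo.unique {a : ℕ → TreeTerm L V} {t t' : TreeTerm L V}
    (h : ConvergesTo a t) (h' : ConvergesTo a t') : t = t' := by
  ext1
  funext p
  obtain ⟨N, hN⟩ := h p.length
  obtain ⟨N', hN'⟩ := h' p.length
  rw [← hN (max N N') (le_max_left _ _) p le_rfl, hN' (max N N') (le_max_right _ _) p le_rfl]

end Terms

/-! ### Substitutions -/

/-- A substitution: a map from variables to finite terms that moves finitely many variables. -/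
structure Subst (L : FirstOrder.Language.{u, v}) (V : Type w) where
  toFun : V → L.Term V
  finite_dom : {x | toFun x ≠ FirstOrder.Language.Term.var x}.Finite

section Substitutions

variable {L : FirstOrder.Language.{u, v}} {V : Type w}

def Subst.dom (σ : Subst L V) : Set V := {x | σ.toFun x ≠ FirstOrder.Language.Term.var x}

/-- The number of bindings of `σ`. -/
noncomputable def Subst.card (σ : Subst L V) : ℕ := σ.dom.ncard

/-- `σ.pow n t` is the term `t σⁿ`. -/
def Subst.pow (σ : Subst L V) (n : ℕ) (t : L.Term V) : L.Term V :=
  (fun s : L.Term V => s.subst σ.toFun)^[n] t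

/-- Some subset of the bindings of `σ` is circular, i.e. of the form
`{x₀ ↦ x₁, …, xₙ₋₂ ↦ xₙ₋₁, xₙ₋₁ ↦ x₀}` with `n > 1` and distinct variables `x₀, …, xₙ₋₁`. -/
def Subst.HasCircularSubset (σ : Subst L V) : Prop :=
  ∃ (n : ℕ) (x : ℕ → V), 1 < n ∧ Set.InjOn x (Set.Iio n) ∧
    (∀ i, i + 1 < n → σ.toFun (x i) = FirstOrder.Language.Term.var (x (i + 1))) ∧
    σ.toFun (x (n - 1)) = FirstOrder.Language.Term.var (x 0)

/-- The substitutions in rational solved form. -/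
structure RSubst (L : FirstOrder.Language.{u, v}) (V : Type w) extends Subst L V where
  not_circular : ¬ toSubst.HasCircularSubset

theorem Subst.pow_succ (σ : Subst L V) (n : ℕ) (t : L.Term V) :
    σ.pow (n + 1) t = σ.pow n (t.subst σ.toFun) := rfl

theorem Subst.pow_add (σ : Subst L V) (m n : ℕ) (t : L.Term V) :
    σ.pow (m + n) t = σ.pow m (σ.pow n t) := Function.iterate_add_apply _ m n t

theorem Subst.pow_func (σ : Subst L V) (n : ℕ) {k : ℕ} (f : L.Functions k)
    (ts : Fin k → L.Term V) :
    σ.pow n (.func f ts) = .func f (fun i => σ.pow n (ts i)) := by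
  induction n generalizing ts with
  | zero => rfl
  | succ n ih => simp only [Subst.pow_succ]; exact ih _

theorem Subst.pow_var_of_notMem (σ : Subst L V) {x : V} (hx : x ∉ σ.dom) (n : ℕ) :
    σ.pow n (.var x) = .var x := by
  induction n with
  | zero => rfl
  | succ n ih =>
    have h : σ.toFun x = FirstOrder.Language.Term.var x := by simpa [Subst.dom] using hx
    rw [Subst.pow_succ, FirstOrder.Language.Term.subst, h, ih]

/-- After `#σ` steps a variable has become a nonvariable term or a variable outside the domain. -/
theorem RSubst.pow_card_var (σ : RSubst L V) (x z : V)
    (h : σ.pow σ.card (.var x) = .var z) : z ∉ σ.dom := by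
  intro hz
  have : Nonempty V := ⟨x⟩
  have hall : ∀ i ≤ σ.card, ∃ y ∈ σ.dom, σ.pow i (.var x) = .var y := by
    intro i hi
    have hadd : σ.pow (σ.card - i) (σ.pow i (.var x)) = .var z := by
      rw [← Subst.pow_add, Nat.sub_add_cancel hi, h]
    cases hp : σ.pow i (.var x) with
    | var y =>
      refine ⟨y, ?_, rfl⟩
      by_contra hy
      rw [hp, Subst.pow_var_of_notMem _ hy] at hadd
      cases hadd
      exact hy hz
    | func f ts =>
      rw [hp, Subst.pow_func] at hadd
      cases hadd
  choose! y hyd hy using hall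
  have hstep : ∀ i, i + 1 ≤ σ.card → σ.toFun (y i) = .var (y (i + 1)) := by
    intro i hi
    have h1 := hy (i + 1) hi
    rw [Nat.add_comm, Subst.pow_add, hy i (by omega)] at h1
    rw [Nat.add_comm i 1]
    exact h1
  obtain ⟨i, hi, j, hj, hij, heq⟩ := Set.exists_ne_map_eq_of_ncard_lt_of_maps_to
    (s := (Finset.range (σ.card + 1) : Set ℕ)) (t := σ.dom) (f := y)
    (by rw [Set.ncard_coe_finset, Finset.card_range]; exact Nat.lt_succ_self _)
    (fun i hi => hyd i (by simpa [Nat.lt_succ_iff] using hi)) σ.finite_dom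
  simp only [Finset.coe_range, Set.mem_Iio, Nat.lt_succ_iff] at hi hj
  wlog hlt : i < j generalizing i j
  · exact this j i hij.symm heq.symm hj hi (by omega)
  classical
  let next : V → V := fun a => if ha : ∃ b : V, σ.toFun a = .var b then ha.choose else a
  have hnext : ∀ a b : V, σ.toFun a = .var b → next a = b := by
    intro a b hab
    have ha : ∃ b : V, σ.toFun a = .var b := ⟨b, hab⟩
    have := ha.choose_spec.symm.trans hab
    simp only [next, dif_pos ha]
    exact FirstOrder.Language.Term.var.inj this
  have hit : ∀ k, i + k ≤ σ.card → next^[k] (y i) = y (i + k) := by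
    intro k
    induction k with
    | zero => intro _; rfl
    | succ k ih =>
      intro hk
      rw [Function.iterate_succ_apply', ih (by omega)]
      exact hnext _ _ (hstep (i + k) (by omega))
  have hper : Function.IsPeriodicPt next (j - i) (y i) := by
    change next^[j - i] (y i) = y i
    rw [hit (j - i) (by omega), Nat.add_sub_cancel' hlt.le, heq]
  have hpos : 0 < Function.minimalPeriod next (y i) := hper.minimalPeriod_pos (by omega)
  have hle : Function.minimalPeriod next (y i) ≤ j - i := hper.minimalPeriod_le (by omega)
  have hs : ∀ k, k < Function.minimalPeriod next (y i) →
      σ.toFun (next^[k] (y i)) = .var (next^[k + 1] (y i)) := by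
    intro k hk
    rw [hit k (by omega), hit (k + 1) (by omega)]
    exact hstep (i + k) (by omega)
  refine σ.not_circular ⟨Function.minimalPeriod next (y i), fun k => next^[k] (y i), ?_,
    Function.iterate_injOn_Iio_minimalPeriod, fun k hk => hs k (by omega), ?_⟩
  · by_contra hn
    have h1 : Function.minimalPeriod next (y i) = 1 := by omega
    have h2 := hs 0 hpos
    have h3 : next^[1] (y i) = y i := by
      have := Function.iterate_minimalPeriod (f := next) (x := y i)
      rwa [h1] at this
    rw [h3] at h2
    exact hyd i hi h2
  · have h2 := hs (Function.minimalPeriod next (y i) - 1) (by omega)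
    rw [Nat.sub_add_cancel hpos, Function.iterate_minimalPeriod] at h2
    exact h2

theorem RSubst.termLabel_pow_stable (σ : RSubst L V) (k : ℕ) : ∀ (t : L.Term V) (n : ℕ),
    σ.card * (k + 1) ≤ n → ∀ p : List ℕ, p.length ≤ k →
      termLabel (σ.pow n t) p = termLabel (σ.pow (σ.card * (k + 1)) t) p := by
  have key : ∀ (k : ℕ) (t : L.Term V) (n : ℕ), σ.card * k ≤ n → ∀ p : List ℕ, p.length < k →
      termLabel (σ.pow n t) p = termLabel (σ.pow (σ.card * k) t) p := by
    intro k
    induction k with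
    | zero => intro t n _ p hp; omega
    | succ k ih =>
      have hfun : ∀ (N : ℕ), σ.card * k ≤ N → ∀ {a : ℕ} (f : L.Functions a)
          (ts : Fin a → L.Term V) (p : List ℕ), p.length < k + 1 →
          termLabel (σ.pow N (.func f ts)) p =
            termLabel (σ.pow (σ.card * k) (.func f ts)) p := by
        intro N hN a f ts p hp
        rw [Subst.pow_func, Subst.pow_func]
        cases p with
        | nil => simp [termLabel]
        | cons i p =>
          simp only [termLabel]
          split
          · exact ih _ N hN p (by simpa using hp)
          · rfl
      intro t n hn p hp
      rw [Nat.mul_succ] at hn ⊢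
      cases t with
      | func f ts =>
        exact (hfun n (by omega) f ts p hp).trans (hfun _ (by omega) f ts p hp).symm
      | var x =>
        obtain ⟨m, rfl⟩ : ∃ m, n = m + σ.card := ⟨n - σ.card, by omega⟩
        rw [Subst.pow_add, Subst.pow_add]
        cases hx : σ.pow σ.card (.var x) with
        | var z =>
          have hz := σ.pow_card_var x z hx
          rw [Subst.pow_var_of_notMem _ hz, Subst.pow_var_of_notMem _ hz]
        | func f ts => exact hfun m (by omega) f ts p hp
  intro t n hn p hp
  exact key (k + 1) t n hn p (by omega)

/-- For `σ` in rational solved form, the sequence `s, sσ, sσ², …` converges. -/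
theorem RSubst.exists_limit (s : L.Term V) (σ : RSubst L V) :
    ∃ t : TreeTerm L V, ConvergesTo (fun n => ofTerm (σ.pow n s)) t := by
  have hst : ∀ (k : ℕ) (p : List ℕ), p.length ≤ k →
      termLabel (σ.pow (σ.card * (k + 1)) s) p =
        termLabel (σ.pow (σ.card * (p.length + 1)) s) p := by
    intro k p hp
    exact σ.termLabel_pow_stable p.length s _ (Nat.mul_le_mul_left _ (by omega)) p le_rfl
  refine ⟨⟨fun p => termLabel (σ.pow (σ.card * (p.length + 1)) s) p, termLabel_nil _, ?_⟩, ?_⟩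
  · intro p i
    have h := hst (p ++ [i]).length p (by simp)
    rw [← h]
    exact termLabel_snoc _ p i
  · intro k
    refine ⟨σ.card * (k + 1), fun n hn p hp => ?_⟩
    change termLabel (σ.pow n s) p = termLabel (σ.pow (σ.card * (p.length + 1)) s) p
    rw [σ.termLabel_pow_stable k s n hn p hp, hst k p hp]

/-- `rt s σ = σ^∞(s)` is the limit of the sequence `s, sσ, sσ², …`. -/
noncomputable def rt (s : L.Term V) (σ : RSubst L V) : TreeTerm L V :=
  (σ.exists_limit s).choose

theorem convergesTo_rt (s : L.Term V) (σ : RSubst L V) :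
    ConvergesTo (fun n => ofTerm (σ.pow n s)) (rt s σ) :=
  (σ.exists_limit s).choose_spec

end Substitutions

/-! ### The abstract domain -/

/-- The sharing groups: the nonempty sets of variables of interest. -/
def SG {V : Type w} (VI : Finset V) : Set (Set V) := {S | S ⊆ ↑VI ∧ S ≠ ∅}

/-- The elements `⟨sh, f, l⟩` of the domain of sharing, freeness and linearity. -/
structure SFL {V : Type w} (VI : Finset V) where
  sh : Set (Set V)
  f : Set V
  l : Set V
  sh_sub : sh ⊆ SG VI
  f_sub : f ⊆ ↑VI
  l_sub : l ⊆ ↑VI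

section Abstraction

variable {L : FirstOrder.Language.{u, v}} {V : Type w}

/-- `occ σ v` is the set of the `y` such that `v` is a variable of `y σⁿ`, where `n = #σ`, not
in the domain of `σ`. -/
def occ (σ : RSubst L V) (v : V) : Set V :=
  {y | v ∈ vars (ofTerm (σ.pow σ.card (.var y))) \ σ.dom}

def ssets (VI : Finset V) (σ : RSubst L V) : Set (Set V) :=
  {S | ∃ v : V, S = occ σ v ∩ ↑VI} \ {∅}

def fvars (σ : RSubst L V) : Set V :=
  {y | ofTerm (σ.pow σ.card (.var y)) ∈ VarTerms}

def lvars (σ : RSubst L V) : Set V :=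
  {y | ∀ z ∈ vars (ofTerm (σ.pow σ.card (.var y))) \ σ.dom,
    OccLin z (ofTerm (σ.pow (2 * σ.card) (.var y)))}

/-- The concretization function. -/
def gammaS {VI : Finset V} (d : SFL VI) : Set (RSubst L V) :=
  {σ | ssets VI σ ⊆ d.sh ∧ d.f ⊆ fvars σ ∧ d.l ⊆ lvars σ}

/-- The relevant component of a sharing set with respect to `W`. -/
def rel (W : Set V) (sh : Set (Set V)) : Set (Set V) := {S ∈ sh | S ∩ W ≠ ∅}

namespace SFL

variable {VI : Finset V}

/-- `s` and `t` are independent in `d`. -/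
def ind (d : SFL VI) (s t : L.Term V) : Prop :=
  rel (vars (ofTerm s)) d.sh ∩ rel (vars (ofTerm t)) d.sh = ∅

/-- `t` is ground in `d`. -/
def ground (d : SFL VI) (t : L.Term V) : Prop := vars (ofTerm t) ⊆ ↑VI \ ⋃₀ d.sh

/-- `y` occurs linearly in `t` in `d`. -/
def occLin (d : SFL VI) (y : V) (t : L.Term V) : Prop :=
  d.ground (.var y : L.Term V) ∨
    (OccLin y (ofTerm t) ∧ y ∈ d.l ∧
      ∀ z ∈ vars (ofTerm t), y ≠ z → d.ind (.var y : L.Term V) (.var z))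

/-- `t` is free in `d`: it is one of the variables in the freeness component. -/
def free (d : SFL VI) (t : L.Term V) : Prop := ∃ x ∈ d.f, t = .var x

/-- `t` is linear in `d`. -/
def lin (d : SFL VI) (t : L.Term V) : Prop := ∀ y ∈ vars (ofTerm t), d.occLin y t

/-- The variables of interest that may share with `t`. -/
def shareWith (d : SFL VI) (t : L.Term V) : Set V := ⋃₀ rel (vars (ofTerm t)) d.sh

end SFL

end Abstraction

end RationalTrees

namespace RationalTrees

open FirstOrder.Language

section Auxiliary

variable {L : FirstOrder.Language.{u, v}} {V : Type w}

/-! A variable `v` of `rt t σ` lies outside the domain, and each of its occurrences is already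
present in all late iterates `t σᵐ`, below a leaf `x` of `t`. The abstract domain only inspects `x
σⁿ` and `x σ²ⁿ` with `n = #σ`, so unbounded `m` must be reduced to these exponents.

Both reductions are pigeonhole arguments (`subset_ncard_of_stable`). The set of domain variables
whose `k`-th iterate contains `v` grows with `k` and cannot resume growing after a pause, so it is
constant from `n` on. Double occurrences behave likewise once single ones have settled, which costs
another `n` steps.

Hence `x ∈ occ σ v`, and when `x` is of interest `occ σ v ∩ VI` is a sharing group in `sh`.
Independence and groundness exclude such groups; linearity also uses `lvars`. Freeness is direct:
without circular bindings, a variable reached after `n` steps is fixed by `σ`. -/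

/-- An increasing sequence of subsets of a finite set `T` whose growth stops for good as soon as
it pauses is constant from the index `T.ncard` on. -/
theorem subset_ncard_of_stable {α : Type*} {S : ℕ → Set α} {T : Set α} (hT : T.Finite)
    (hmono : Monotone S) (hST : ∀ k, S k ⊆ T)
    (hstable : ∀ k, S k = S (k + 1) → S (k + 1) = S (k + 2)) (m : ℕ) : S m ⊆ S T.ncard := by
  have hconst : ∀ k, S k = S (k + 1) → ∀ j, S (k + j) = S k ∧ S (k + j) = S (k + j + 1) := by
    intro k hk j
    induction j with
    | zero => exact ⟨rfl, hk⟩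
    | succ j ih => exact ⟨ih.2.symm.trans ih.1, hstable _ ih.2⟩
  by_cases h : ∃ k ≤ T.ncard, S k = S (k + 1)
  · obtain ⟨k, hkn, hk⟩ := h
    rcases le_total m k with hmk | hkm
    · exact hmono (hmk.trans hkn)
    · obtain ⟨j, rfl⟩ := Nat.exists_eq_add_of_le hkm
      rw [(hconst k hk j).1]
      exact hmono hkn
  · push Not at h
    -- Without a pause up to `T.ncard`, each step adds an element, so the set at index `T.ncard + 1`
    -- would be larger than `T`.
    have hcard : ∀ k ≤ T.ncard + 1, k ≤ (S k).ncard := by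
      intro k
      induction k with
      | zero => intro _; exact Nat.zero_le _
      | succ k ih =>
        intro hk
        have hlt : (S k).ncard < (S (k + 1)).ncard :=
          Set.ncard_lt_ncard ((hmono (Nat.le_succ k)).ssubset_of_ne (h k (by omega)))
            (hT.subset (hST _))
        have := ih (by omega)
        omega
    have h1 := hcard _ le_rfl
    have h2 := Set.ncard_le_ncard (hST (T.ncard + 1)) hT
    omega

/-! ### Occurrences of variables in iterates -/

/-- Substitution only grows a tree at its variable leaves, so the path to a variable splits at a
leaf of the original term. -/
theorem termLabel_pow_eq_var_iff (σ : Subst L V) (n : ℕ) (t : L.Term V) (p : List ℕ) (v : V) :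
    termLabel (σ.pow n t) p = some (Sum.inl v) ↔
      ∃ p₁ p₂ x, p = p₁ ++ p₂ ∧ termLabel t p₁ = some (Sum.inl x) ∧
        termLabel (σ.pow n (.var x)) p₂ = some (Sum.inl v) := by
  induction t generalizing p with
  | var x =>
    constructor
    · intro h
      exact ⟨[], p, x, rfl, by simp [termLabel], h⟩
    · rintro ⟨p₁, p₂, y, rfl, h1, h2⟩
      cases p₁ with
      | nil =>
        simp only [termLabel, Option.some.injEq, Sum.inl.injEq] at h1
        subst h1
        exact h2
      | cons i p₁ => simp [termLabel] at h1
  | @func k f ts ih =>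
    rw [Subst.pow_func]
    constructor
    · intro h
      cases p with
      | nil => simp [termLabel] at h
      | cons i p =>
        by_cases hi : i < k
        · simp only [termLabel, hi, dite_true] at h
          obtain ⟨p₁, p₂, x, rfl, h1, h2⟩ := (ih _ _).1 h
          exact ⟨i :: p₁, p₂, x, rfl, by simpa [termLabel, hi] using h1, h2⟩
        · simp [termLabel, hi] at h
    · rintro ⟨p₁, p₂, x, rfl, h1, h2⟩
      cases p₁ with
      | nil => simp [termLabel] at h1
      | cons i p₁ =>
        by_cases hi : i < k
        · simp only [termLabel, hi, dite_true, List.cons_append] at h1 ⊢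
          exact (ih _ _).2 ⟨p₁, p₂, x, rfl, h1, h2⟩
        · simp [termLabel, hi] at h1

/-- No leaf labelled by a variable lies strictly below another one. -/
theorem prefix_eq_of_termLabel_eq_var {t : L.Term V} {p₁ p₂ q₁ q₂ : List ℕ} {x y : V}
    (h : p₁ ++ p₂ = q₁ ++ q₂) (hp : termLabel t p₁ = some (Sum.inl x))
    (hq : termLabel t q₁ = some (Sum.inl y)) : p₁ = q₁ := by
  induction t generalizing p₁ q₁ with
  | var z =>
    cases p₁ <;> cases q₁ <;> simp_all [termLabel]
  | @func k f ts ih =>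
    cases p₁ with
    | nil => simp [termLabel] at hp
    | cons i p₁ =>
      cases q₁ with
      | nil => simp [termLabel] at hq
      | cons j q₁ =>
        simp only [List.cons_append, List.cons.injEq] at h
        obtain ⟨rfl, h⟩ := h
        by_cases hi : i < k
        · simp only [termLabel, hi, dite_true] at hp hq
          rw [ih _ h hp hq]
        · simp [termLabel, hi] at hp

theorem eq_var_of_termLabel_nil {t : L.Term V} {x : V}
    (h : termLabel t [] = some (Sum.inl x)) : t = .var x := by
  cases t with
  | var y => simpa [termLabel] using h
  | func f ts => simp [termLabel] at h

/-- The occurrences of a variable outside the domain persist. -/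
theorem termLabel_pow_mono (σ : Subst L V) {v : V} (hv : v ∉ σ.dom) {m n : ℕ} (hmn : m ≤ n)
    {t : L.Term V} {p : List ℕ} (h : termLabel (σ.pow m t) p = some (Sum.inl v)) :
    termLabel (σ.pow n t) p = some (Sum.inl v) := by
  obtain ⟨k, rfl⟩ := Nat.exists_eq_add_of_le hmn
  rw [Nat.add_comm, Subst.pow_add]
  exact (termLabel_pow_eq_var_iff σ k _ p v).2
    ⟨p, [], v, by simp, h, by simp [Subst.pow_var_of_notMem σ hv, termLabel]⟩

/-- A variable outside the domain that occurs in some `x σᵐ` occurs in `x σⁿ`, `n = #σ`. -/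
theorem exists_termLabel_pow_card (σ : Subst L V) {v : V} (hv : v ∉ σ.dom) {m : ℕ} {x : V}
    (h : ∃ p, termLabel (σ.pow m (.var x)) p = some (Sum.inl v)) :
    ∃ p, termLabel (σ.pow σ.card (.var x)) p = some (Sum.inl v) := by
  -- Restricting to the domain makes `#σ` the pigeonhole bound; other variables are fixed by `σ`.
  let S : ℕ → Set V := fun k =>
    {x ∈ σ.dom | ∃ p, termLabel (σ.pow k (.var x)) p = some (Sum.inl v)}
  have hmono : Monotone S := fun a b hab x ⟨hx, p, hp⟩ =>
    ⟨hx, p, termLabel_pow_mono σ hv hab hp⟩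
  by_cases hx : x ∈ σ.dom
  · refine (subset_ncard_of_stable (S := S) σ.finite_dom hmono (fun k x hx => hx.1) ?_ m
      ⟨hx, h⟩).2
    -- Peel off the first application of `σ`: the occurrence lies below some leaf `y` of `x σ`, and
    -- the pause moves it one iterate earlier below `y`.
    refine fun k hk => (hmono (Nat.le_succ _)).antisymm ?_
    rintro x ⟨hx, p, hp⟩
    rw [Subst.pow_succ] at hp
    obtain ⟨p₁, p₂, y, rfl, h1, h2⟩ := (termLabel_pow_eq_var_iff σ _ _ p v).1 hp
    obtain ⟨q, hq⟩ : ∃ q, termLabel (σ.pow k (.var y)) q = some (Sum.inl v) := by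
      by_cases hy : y ∈ σ.dom
      · have hmem : y ∈ S (k + 1) := ⟨hy, p₂, h2⟩
        rw [← hk] at hmem
        exact hmem.2
      · rw [Subst.pow_var_of_notMem σ hy] at h2 ⊢
        exact ⟨p₂, h2⟩
    refine ⟨hx, p₁ ++ q, ?_⟩
    rw [Subst.pow_succ]
    exact (termLabel_pow_eq_var_iff σ _ _ _ v).2 ⟨p₁, q, y, rfl, h1, hq⟩
  · rw [Subst.pow_var_of_notMem σ hx] at h ⊢
    exact h

/-- A variable outside the domain that occurs at least twice in some `x σᵐ` occurs at least twice
in `x σ²ⁿ`, `n = #σ`. -/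
theorem exists_two_termLabel_pow_two_mul_card (σ : Subst L V) {v : V} (hv : v ∉ σ.dom) {m : ℕ}
    {x : V} (h : ∃ p q, p ≠ q ∧ termLabel (σ.pow m (.var x)) p = some (Sum.inl v) ∧
      termLabel (σ.pow m (.var x)) q = some (Sum.inl v)) :
    ∃ p q, p ≠ q ∧ termLabel (σ.pow (2 * σ.card) (.var x)) p = some (Sum.inl v) ∧
      termLabel (σ.pow (2 * σ.card) (.var x)) q = some (Sum.inl v) := by
  -- The offset `#σ` ensures that single occurrences have settled; it is the first half of the
  -- exponent `2 * #σ`.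
  let S : ℕ → Set V := fun k =>
    {x | ∃ p q, p ≠ q ∧ termLabel (σ.pow (σ.card + k) (.var x)) p = some (Sum.inl v) ∧
      termLabel (σ.pow (σ.card + k) (.var x)) q = some (Sum.inl v)}
  have hmono : Monotone S := fun a b hab x ⟨p, q, hpq, hp, hq⟩ =>
    ⟨p, q, hpq, termLabel_pow_mono σ hv (by omega) hp, termLabel_pow_mono σ hv (by omega) hq⟩
  have hdom : ∀ k, S k ⊆ σ.dom := by
    rintro k x ⟨p, q, hpq, hp, hq⟩
    by_contra hx
    rw [Subst.pow_var_of_notMem σ hx] at hp hq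
    cases p <;> cases q <;> simp_all [termLabel]
  have hstable : ∀ k, S k = S (k + 1) → S (k + 1) = S (k + 2) := by
    refine fun k hk => (hmono (Nat.le_succ _)).antisymm ?_
    rintro x ⟨p, q, hpq, hp, hq⟩
    change termLabel (σ.pow (σ.card + (k + 1)) ((FirstOrder.Language.Term.var x).subst σ.toFun)) _
      = _ at hp hq
    change ∃ p q, p ≠ q ∧
      termLabel (σ.pow (σ.card + k) ((FirstOrder.Language.Term.var x).subst σ.toFun)) p = _ ∧
      termLabel (σ.pow (σ.card + k) ((FirstOrder.Language.Term.var x).subst σ.toFun)) q = _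
    obtain ⟨p₁, p₂, y, rfl, hp1, hp2⟩ := (termLabel_pow_eq_var_iff σ _ _ _ v).1 hp
    obtain ⟨q₁, q₂, z, rfl, hq1, hq2⟩ := (termLabel_pow_eq_var_iff σ _ _ _ v).1 hq
    by_cases hpq1 : p₁ = q₁
    · subst hpq1
      obtain rfl : y = z := by simpa using hp1.symm.trans hq1
      have hmem : y ∈ S (k + 1) := ⟨p₂, q₂, fun h => hpq (by rw [h]), hp2, hq2⟩
      rw [← hk] at hmem
      obtain ⟨p', q', hne, hp', hq'⟩ := hmem
      exact ⟨p₁ ++ p', p₁ ++ q', fun h => hne (List.append_cancel_left h),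
        (termLabel_pow_eq_var_iff σ _ _ _ v).2 ⟨_, _, y, rfl, hp1, hp'⟩,
        (termLabel_pow_eq_var_iff σ _ _ _ v).2 ⟨_, _, y, rfl, hq1, hq'⟩⟩
    -- Below two different leaves of `x σ`, one occurrence each suffices, and `#σ` steps already
    -- supply it.
    · obtain ⟨p', hp'⟩ := exists_termLabel_pow_card σ hv ⟨p₂, hp2⟩
      obtain ⟨q', hq'⟩ := exists_termLabel_pow_card σ hv ⟨q₂, hq2⟩
      have hle : σ.card ≤ σ.card + k := Nat.le_add_right _ _
      exact ⟨p₁ ++ p', q₁ ++ q', fun h => hpq1 (prefix_eq_of_termLabel_eq_var h hp1 hq1),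
        (termLabel_pow_eq_var_iff σ _ _ _ v).2
          ⟨_, _, y, rfl, hp1, termLabel_pow_mono σ hv hle hp'⟩,
        (termLabel_pow_eq_var_iff σ _ _ _ v).2
          ⟨_, _, z, rfl, hq1, termLabel_pow_mono σ hv hle hq'⟩⟩
  obtain ⟨p, q, hpq, hp, hq⟩ := h
  have hmem : x ∈ S m := ⟨p, q, hpq, termLabel_pow_mono σ hv (Nat.le_add_left _ _) hp,
    termLabel_pow_mono σ hv (Nat.le_add_left _ _) hq⟩
  rw [Nat.two_mul]
  exact subset_ncard_of_stable σ.finite_dom hmono hdom hstable m hmem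

/-! ### Variables of the limit -/

/-- The variables of the limit are outside the domain and are already in place after finitely
many steps. -/
theorem rt_label_eq_var {t : L.Term V} {σ : RSubst L V} {p : List ℕ} {v : V}
    (h : (rt t σ).label p = some (Sum.inl v)) :
    v ∉ σ.dom ∧ ∃ N, ∀ n, N ≤ n → termLabel (σ.pow n t) p = some (Sum.inl v) := by
  obtain ⟨N, hN⟩ := convergesTo_rt t σ p.length
  have hlim : ∀ n, N ≤ n → termLabel (σ.pow n t) p = some (Sum.inl v) :=
    fun n hn => (hN n hn p le_rfl).trans h
  refine ⟨fun hv => hv ?_, N, hlim⟩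
  -- One further step leaves the leaf `v` at `p` unchanged, so `σ` fixes `v`.
  have h1 := hlim (1 + N) (by omega)
  rw [Subst.pow_add] at h1
  obtain ⟨p₁, p₂, x, hp, hx, h2⟩ := (termLabel_pow_eq_var_iff _ _ _ _ _).1 h1
  have hNv := hlim N le_rfl
  obtain rfl : p₁ = p :=
    prefix_eq_of_termLabel_eq_var (p₂ := p₂) (q₂ := []) (by rw [List.append_nil, ← hp]) hx hNv
  obtain rfl : x = v := by simpa using hx.symm.trans hNv
  obtain rfl : p₂ = [] := by simpa using hp
  exact eq_var_of_termLabel_nil h2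

/-- A variable of the limit of `t` comes from a variable of `t`. -/
theorem exists_mem_occ_of_mem_vars_rt {t : L.Term V} {σ : RSubst L V} {v : V}
    (h : v ∈ vars (rt t σ)) : ∃ x ∈ vars (ofTerm t), x ∈ occ σ v := by
  obtain ⟨p, hp⟩ := h
  obtain ⟨hv, N, hN⟩ := rt_label_eq_var hp
  obtain ⟨p₁, p₂, x, -, hx, h2⟩ := (termLabel_pow_eq_var_iff _ _ _ _ _).1 (hN N le_rfl)
  exact ⟨x, ⟨p₁, hx⟩, exists_termLabel_pow_card σ.toSubst hv ⟨p₂, h2⟩, hv⟩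

/-! ### Soundness of the abstract predicates -/

variable {VI : Finset V} {d : SFL VI} {σ : RSubst L V}

theorem occ_inter_mem_sh (hσ : σ ∈ gammaS d) {v x : V} (hx : x ∈ VI) (hxv : x ∈ occ σ v) :
    occ σ v ∩ ↑VI ∈ d.sh :=
  hσ.1 ⟨⟨v, rfl⟩, Set.nonempty_iff_ne_empty.1 ⟨x, hxv, hx⟩⟩

theorem vars_var (x : V) : vars (ofTerm (.var x : L.Term V)) = {x} := by
  ext y
  constructor
  · rintro ⟨p, hp⟩
    cases p with
    | nil => simpa [ofTerm, termLabel, eq_comm] using hp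
    | cons i p => simp [ofTerm, termLabel] at hp
  · rintro rfl
    exact ⟨[], by simp [ofTerm, termLabel]⟩

/-- The single group `occ σ v ∩ VI` meets the variables of both terms. -/
theorem SFL.not_ind_of_mem_occ (hσ : σ ∈ gammaS d) {s t : L.Term V} {v x y : V}
    (hxVI : x ∈ VI) (hyVI : y ∈ VI) (hx : x ∈ vars (ofTerm s)) (hy : y ∈ vars (ofTerm t))
    (hxv : x ∈ occ σ v) (hyv : y ∈ occ σ v) : ¬ d.ind s t := by
  intro h
  have hmem : occ σ v ∩ ↑VI ∈
      RationalTrees.rel (vars (ofTerm s)) d.sh ∩ RationalTrees.rel (vars (ofTerm t)) d.sh :=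
    ⟨⟨occ_inter_mem_sh hσ hxVI hxv, Set.nonempty_iff_ne_empty.1 ⟨x, ⟨hxv, hxVI⟩, hx⟩⟩,
      ⟨occ_inter_mem_sh hσ hxVI hxv, Set.nonempty_iff_ne_empty.1 ⟨y, ⟨hyv, hyVI⟩, hy⟩⟩⟩
  have h' : _ = ∅ := h
  rw [h'] at hmem
  exact hmem

theorem SFL.not_ground_of_mem_occ (hσ : σ ∈ gammaS d) {t : L.Term V} {v x : V}
    (hxVI : x ∈ VI) (hx : x ∈ vars (ofTerm t)) (hxv : x ∈ occ σ v) : ¬ d.ground t :=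
  fun h => (h hx).2 ⟨_, occ_inter_mem_sh hσ hxVI hxv, hxv, hxVI⟩

theorem SFL.vars_rt_inter_eq_empty (hσ : σ ∈ gammaS d) {s t : L.Term V}
    (hs : vars (ofTerm s) ⊆ ↑VI) (ht : vars (ofTerm t) ⊆ ↑VI) (h : d.ind s t) :
    vars (rt s σ) ∩ vars (rt t σ) = ∅ := by
  refine Set.eq_empty_of_forall_notMem fun v ⟨hvs, hvt⟩ => ?_
  obtain ⟨x, hx, hxv⟩ := exists_mem_occ_of_mem_vars_rt hvs
  obtain ⟨y, hy, hyv⟩ := exists_mem_occ_of_mem_vars_rt hvt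
  exact not_ind_of_mem_occ hσ (hs hx) (ht hy) hx hy hxv hyv h

theorem SFL.ind_var_iff (d : SFL VI) (y : V) (t : L.Term V) :
    d.ind (.var y) t ↔ y ∉ d.shareWith t := by
  simp only [SFL.ind, SFL.shareWith, vars_var, Set.eq_empty_iff_forall_notMem, Set.mem_inter_iff,
    Set.mem_sUnion, not_exists, not_and]
  have hrel : ∀ S, S ∈ RationalTrees.rel {y} d.sh ↔ S ∈ d.sh ∧ y ∈ S := by
    intro S
    simp [RationalTrees.rel]
  constructor
  · intro h S hS hy
    exact h S ((hrel S).2 ⟨hS.1, hy⟩) hS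
  · intro h S hS hS'
    exact h S hS' ((hrel S).1 hS).2

theorem SFL.rt_mem_varTerms (hσ : σ ∈ gammaS d) {t : L.Term V} (h : d.free t) :
    rt t σ ∈ VarTerms := by
  obtain ⟨x, hx, rfl⟩ := h
  obtain ⟨z, hz⟩ := hσ.2.1 hx
  have hz' : σ.pow σ.card (.var x) = .var z :=
    eq_var_of_termLabel_nil (by
      have := congrArg (fun t => t.label []) hz
      simpa [ofTerm, termLabel] using this)
  -- By `RSubst.pow_card_var`, `z` is outside the domain, so the sequence is constant from `#σ` on.
  refine ⟨z, (convergesTo_rt _ σ).unique fun k => ⟨σ.card, fun n hn p _ => ?_⟩⟩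
  obtain ⟨m, rfl⟩ := Nat.exists_eq_add_of_le' hn
  change (ofTerm (σ.pow _ _)).label p = _
  rw [Subst.pow_add, hz', Subst.pow_var_of_notMem _ (σ.pow_card_var x z hz')]

theorem SFL.rt_mem_gTerms (hσ : σ ∈ gammaS d) {t : L.Term V} (ht : vars (ofTerm t) ⊆ ↑VI)
    (h : d.ground t) : rt t σ ∈ GTerms := by
  refine Set.eq_empty_of_forall_notMem fun v hv => ?_
  obtain ⟨x, hx, hxv⟩ := exists_mem_occ_of_mem_vars_rt hv
  exact not_ground_of_mem_occ hσ (ht hx) hx hxv h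

theorem SFL.rt_mem_lTerms (hσ : σ ∈ gammaS d) {t : L.Term V} (ht : vars (ofTerm t) ⊆ ↑VI)
    (h : d.lin t) : rt t σ ∈ LTerms := by
  rintro v ⟨p, hp⟩
  refine ⟨p, hp, fun q hq => ?_⟩
  obtain ⟨hv, M, hM⟩ := rt_label_eq_var hp
  obtain ⟨-, N, hN⟩ := rt_label_eq_var hq
  -- The common exponent `max M N` places both occurrences of `v` in the same iterate.
  obtain ⟨p₁, p₂, x, rfl, hp1, hp2⟩ :=
    (termLabel_pow_eq_var_iff _ _ _ _ _).1 (hM (max M N) (le_max_left _ _))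
  obtain ⟨q₁, q₂, z, rfl, hq1, hq2⟩ :=
    (termLabel_pow_eq_var_iff _ _ _ _ _).1 (hN (max M N) (le_max_right _ _))
  have hx : x ∈ vars (ofTerm t) := ⟨p₁, hp1⟩
  have hz : z ∈ vars (ofTerm t) := ⟨q₁, hq1⟩
  have hxv : x ∈ occ σ v := ⟨exists_termLabel_pow_card σ.toSubst hv ⟨p₂, hp2⟩, hv⟩
  have hzv : z ∈ occ σ v := ⟨exists_termLabel_pow_card σ.toSubst hv ⟨q₂, hq2⟩, hv⟩
  rcases h x hx with hg | ⟨hlin, hxl, hind⟩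
  · exact (not_ground_of_mem_occ hσ (ht hx) (by simp [vars_var]) hxv hg).elim
  · by_cases hxz : x = z
    · subst hxz
      -- As `x` has one leaf in `t`, distinct occurrences of `v` would both lie in an iterate of
      -- `x`, hence two would appear in `x σ²ⁿ`, against `lvars`.
      obtain rfl : p₁ = q₁ := hlin.unique hp1 hq1
      by_contra hne
      obtain ⟨p', q', hne', hp', hq'⟩ := exists_two_termLabel_pow_two_mul_card σ.toSubst hv
        ⟨p₂, q₂, fun he => hne (by rw [he]), hp2, hq2⟩
      exact hne' ((hσ.2.2 hxl v hxv).unique hp' hq')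
    · exact (not_ind_of_mem_occ hσ (ht hx) (ht hz) (by simp [vars_var]) (by simp [vars_var])
        hxv hzv (hind z hz hxz)).elim

end Auxiliary

end RationalTrees

theorem mainTheorem8 {L : FirstOrder.Language.{u, v}} {V : Type w} (VI : Finset V)
    (d : RationalTrees.SFL VI) (σ : RationalTrees.RSubst L V) (hσ : σ ∈ RationalTrees.gammaS d)
    (y : V) (hy : y ∈ VI) (s t : L.Term V)
    (hst : RationalTrees.vars (RationalTrees.ofTerm s) ∪
      RationalTrees.vars (RationalTrees.ofTerm t) ⊆ ↑VI) :
    (d.ind s t →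
      RationalTrees.vars (RationalTrees.rt s σ) ∩ RationalTrees.vars (RationalTrees.rt t σ) = ∅) ∧
    (d.ind (FirstOrder.Language.Term.var y) t ↔ y ∉ d.shareWith t) ∧
    (d.free t → RationalTrees.rt t σ ∈ RationalTrees.VarTerms) ∧
    (d.ground t → RationalTrees.rt t σ ∈ RationalTrees.GTerms) ∧
    (d.lin t → RationalTrees.rt t σ ∈ RationalTrees.LTerms) := by
  have hs := Set.subset_union_left.trans hst
  have ht := Set.subset_union_right.trans hst
  exact ⟨RationalTrees.SFL.vars_rt_inter_eq_empty hσ hs ht, RationalTrees.SFL.ind_var_iff d y t,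
    RationalTrees.SFL.rt_mem_varTerms hσ, RationalTrees.SFL.rt_mem_gTerms hσ ht,
    RationalTrees.SFL.rt_mem_lTerms hσ ht⟩
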